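/- A \emph{positive modal algebra} is a triple $(L,\Diamond,\Box)$ where $L$ is a bounded distributive lattice (the one-element lattice is allowed) and $\Diamond,\Box$ are unary functions on $L$ such that for all $a,b\in L$: $\Diamond 0=0$, $\Diamond a\vee\Diamond b=\Diamond(a\vee b)$, $\Box 1=1$, $\Box a\wedge\Box b=\Box(a\wedge b)$, $\Box(a\vee b)\le\Box a\vee\Diamond b$, and $\Box a\wedge\Diamond b\le\Diamond(a\wedge b)$. Let $\mathsf{PMA}$ be the category of positive modal algebras and bounded lattice homomorphisms preserving $\Diamond$ and $\Box$. A \emph{Priestley space} is a compact space $X$ with a partial order $\le$ such that whenever $x\not\le y$ there is a clopen upset containing $x$ and missing $y$. A \emph{modal Priestley space} is a pair $(X,R)$ where $X$ is a (possibly empty) Priestley space and $R$ is a binary relation on $X$ such that, writing $R[x]=\{y\mid x\mathrel{R}y\}$: (1) $R[x]$ is closed for every $x\in X$; (2) for every clopen upset $U$, the sets $\Box_R U=\{x\mid R[x]\subseteq U\}$ and $\Diamond_R U=\{x\mid R[x]\cap U\ne\varnothing\}$ are clopen upsets; (3) $R[x]={\uparrow}R[x]\cap{\downarrow}R[x]$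 for every $x\in X$. A map $f:X_1\to X_2$ between modal Priestley spaces $(X_1,R_1)$ and $(X_2,R_2)$ is a \emph{p-morphism} if (1) $f$ is order-preserving; (2) $x\mathrel{R_1}z$ implies $f(x)\mathrel{R_2}f(z)$; (3) $f(x)\mathrel{R_2}y$ implies that there are $z,z'\in X_1$ with $x\mathrel{R_1}z$, $x\mathrel{R_1}z'$ and $f(z)\le y\le f(z')$. Let $\mathsf{MPS}$ be the category of modal Priestley spaces and continuous p-morphisms. Theorem (Celani--Jansana duality). $\mathsf{PMA}$ is dually equivalent to $\mathsf{MPS}$; that is, the categories $\mathsf{PMA}^{\mathrm{op}}$ and $\mathsf{MPS}$ are equivalent. -/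

import Mathlib

open CategoryTheory

universe u

/-- A positive modal algebra: a bounded distributive lattice `L` with unary functions
`dia` (`◇`) and `box` (`□`). The trivial lattice (`⊥ = ⊤`) is allowed. -/
structure PMA : Type (u + 1) where
  carrier : Type u
  [distribLattice : DistribLattice carrier]
  [boundedOrder : BoundedOrder carrier]
  dia : carrier → carrier
  box : carrier → carrier
  dia_bot : dia ⊥ = ⊥
  dia_sup : ∀ a b : carrier, dia a ⊔ dia b = dia (a ⊔ b)
  box_top : box ⊤ = ⊤
  box_inf : ∀ a b : carrier, box a ⊓ box b = box (a ⊓ b)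
  box_sup_le : ∀ a b : carrier, box (a ⊔ b) ≤ box a ⊔ dia b
  box_inf_dia_le : ∀ a b : carrier, box a ⊓ dia b ≤ dia (a ⊓ b)

namespace PMA

instance : CoeSort PMA.{u} (Type u) := ⟨PMA.carrier⟩

attribute [instance] PMA.distribLattice PMA.boundedOrder

/-- Bounded lattice homomorphisms preserving `◇` and `□`. -/
@[ext]
structure Hom (L M : PMA.{u}) : Type u where
  hom : BoundedLatticeHom L M
  map_dia : ∀ a : L, hom (L.dia a) = M.dia (hom a)
  map_box : ∀ a : L, hom (L.box a) = M.box (hom a)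

instance : Category PMA.{u} where
  Hom := Hom
  id L := ⟨BoundedLatticeHom.id L, fun _ => rfl, fun _ => rfl⟩
  comp f g := ⟨g.hom.comp f.hom,
    fun a => by simp [f.map_dia, g.map_dia],
    fun a => by simp [f.map_box, g.map_box]⟩

end PMA

/-- `boxRel R U = {x | R[x] ⊆ U}`. -/
def boxRel {X : Type u} (R : X → X → Prop) (U : Set X) : Set X :=
  {x | {y | R x y} ⊆ U}

/-- `diaRel R U = R⁻¹[U]`. -/
def diaRel {X : Type u} (R : X → X → Prop) (U : Set X) : Set X :=
  {x | ∃ y ∈ U, R x y}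

/-- A modal Priestley space: a Priestley space (compact, partially ordered, and satisfying the
Priestley separation axiom) with a binary relation `rel` subject to the three conditions below. -/
structure MPS : Type (u + 1) where
  carrier : Type u
  [topologicalSpace : TopologicalSpace carrier]
  [partialOrder : PartialOrder carrier]
  [compactSpace : CompactSpace carrier]
  [priestleySpace : PriestleySpace carrier]
  rel : carrier → carrier → Prop
  isClosed_rel : ∀ x : carrier, IsClosed {y | rel x y}
  isClopen_isUpperSet : ∀ U : Set carrier, IsClopen U → IsUpperSet U →
    (IsClopen (boxRel rel U) ∧ IsUpperSet (boxRel rel U)) ∧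
      (IsClopen (diaRel rel U) ∧ IsUpperSet (diaRel rel U))
  rel_eq : ∀ x : carrier, {y | rel x y} =
    (upperClosure {y | rel x y} : Set carrier) ∩ (lowerClosure {y | rel x y} : Set carrier)

namespace MPS

instance : CoeSort MPS.{u} (Type u) := ⟨MPS.carrier⟩

attribute [instance] MPS.topologicalSpace MPS.partialOrder MPS.compactSpace MPS.priestleySpace

/-- The p-morphisms between modal Priestley spaces. -/
structure IsPMorphism {X Y : MPS.{u}} (f : X → Y) : Prop where
  monotone : Monotone f
  forth : ∀ x z : X, X.rel x z → Y.rel (f x) (f z)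
  back : ∀ (x : X) (y : Y), Y.rel (f x) y →
    ∃ z z' : X, X.rel x z ∧ X.rel x z' ∧ f z ≤ y ∧ y ≤ f z'

/-- Continuous p-morphisms. -/
@[ext]
structure Hom (X Y : MPS.{u}) : Type u where
  toFun : X → Y
  continuous : Continuous toFun
  isPMorphism : IsPMorphism toFun

theorem IsPMorphism.id (X : MPS.{u}) : IsPMorphism (fun x : X => x) where
  monotone := monotone_id
  forth _ _ h := h
  back _ y h := ⟨y, y, h, h, le_rfl, le_rfl⟩

theorem IsPMorphism.comp {X Y Z : MPS.{u}} {f : X → Y} {g : Y → Z}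
    (hg : IsPMorphism g) (hf : IsPMorphism f) : IsPMorphism (fun x => g (f x)) where
  monotone := hg.monotone.comp hf.monotone
  forth x z h := hg.forth _ _ (hf.forth x z h)
  back x y h := by
    obtain ⟨w, w', hw, hw', hwy, hyw'⟩ := hg.back _ _ h
    obtain ⟨z, _, hz, _, hzw, _⟩ := hf.back _ _ hw
    obtain ⟨_, z', _, hz', _, hwz'⟩ := hf.back _ _ hw'
    exact ⟨z, z', hz, hz', (hg.monotone hzw).trans hwy, hyw'.trans (hg.monotone hwz')⟩

instance : Category MPS.{u} where
  Hom := Hom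
  id X := ⟨fun x => x, continuous_id, IsPMorphism.id X⟩
  comp f g := ⟨fun x => g.toFun (f.toFun x), g.continuous.comp f.continuous,
    g.isPMorphism.comp f.isPMorphism⟩

end MPS

/-! ### Separation by clopen upsets -/

open TopologicalSpace

/-! The dual of `L` is its space of prime filters, where `p` sees `q` when `□⁻¹p ⊆ q ⊆ ◇⁻¹p`. The
resulting contravariant functor is shown to be fully faithful and essentially surjective.

On the algebra side, the prime filter theorem makes `basic` injective, and compactness makes every
clopen upset basic (`exists_eq_basic`). The two axioms mixing `□` and `◇` supply enough successors
(`exists_specRel_avoiding`, `exists_specRel_containing`) for `basic` to turn `□` and `◇` into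
`boxRel` and `diaRel`. Faithfulness follows from injectivity; for fullness, preimage under a
p-morphism acts on basic sets as a homomorphism.

On the space side, `toSpec` sends a point to its clopen upset neighbourhoods. It is an order
embedding by Priestley separation and surjective by compactness. It reflects the relation because a
closed, order-convex `R[x]` is determined by the clopen upsets that contain it or meet it
(`specRel_toSpec`). -/

/-- In a compact space, a bounded sublattice of clopen sets separating the points of a compact set
`K` from those of a compact set `C` contains a set separating `K` from `C`. -/
theorem exists_mem_separating_compacts {X : Type*} [TopologicalSpace X] {B : Set (Set X)}
    (hclopen : ∀ U ∈ B, IsClopen U) (hempty : ∅ ∈ B) (huniv : Set.univ ∈ B)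
    (hunion : ∀ U ∈ B, ∀ V ∈ B, U ∪ V ∈ B) (hinter : ∀ U ∈ B, ∀ V ∈ B, U ∩ V ∈ B)
    {K C : Set X} (hK : IsCompact K) (hC : IsCompact C)
    (h : ∀ x ∈ K, ∀ y ∈ C, ∃ U ∈ B, x ∈ U ∧ y ∉ U) :
    ∃ U ∈ B, K ⊆ U ∧ C ⊆ Uᶜ := by
  refine hK.induction_on (p := fun K => ∃ U ∈ B, K ⊆ U ∧ C ⊆ Uᶜ)
    ⟨∅, hempty, subset_rfl, by simp⟩ ?_ ?_ ?_
  · rintro s t hst ⟨U, hU, htU, hCU⟩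
    exact ⟨U, hU, hst.trans htU, hCU⟩
  · rintro s t ⟨U, hU, hsU, hCU⟩ ⟨V, hV, htV, hCV⟩
    refine ⟨U ∪ V, hunion U hU V hV, Set.union_subset_union hsU htV, ?_⟩
    rw [Set.compl_union]
    exact Set.subset_inter hCU hCV
  · intro x hx
    obtain ⟨U, hU, hxU, hCU⟩ : ∃ U ∈ B, x ∈ U ∧ C ⊆ Uᶜ := by
      refine hC.induction_on (p := fun C => ∃ U ∈ B, x ∈ U ∧ C ⊆ Uᶜ)
        ⟨Set.univ, huniv, trivial, Set.empty_subset _⟩ ?_ ?_ ?_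
      · rintro s t hst ⟨U, hU, hxU, htU⟩
        exact ⟨U, hU, hxU, hst.trans htU⟩
      · rintro s t ⟨U, hU, hxU, hsU⟩ ⟨V, hV, hxV, htV⟩
        refine ⟨U ∩ V, hinter U hU V hV, ⟨hxU, hxV⟩, ?_⟩
        rw [Set.compl_inter]
        exact Set.union_subset_union hsU htV
      · intro y hy
        obtain ⟨U, hU, hxU, hyU⟩ := h x hx y hy
        exact ⟨Uᶜ, mem_nhdsWithin_of_mem_nhds ((hclopen U hU).compl.isOpen.mem_nhds hyU),
          U, hU, hxU, subset_rfl⟩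
    exact ⟨U, mem_nhdsWithin_of_mem_nhds ((hclopen U hU).isOpen.mem_nhds hxU),
      U, hU, subset_rfl, hCU⟩

/-- In a compact Priestley space, a closed set `K` can be separated by a clopen upper set from a
closed set `C` none of whose elements lies above an element of `K`. -/
theorem exists_clopenUpperSet_separating {X : Type*} [TopologicalSpace X] [PartialOrder X]
    [CompactSpace X] [PriestleySpace X] {K C : Set X} (hK : IsClosed K) (hC : IsClosed C)
    (h : ∀ x ∈ K, ∀ y ∈ C, ¬ x ≤ y) :
    ∃ U : ClopenUpperSet X, K ⊆ U ∧ C ⊆ (U : Set X)ᶜ := by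
  obtain ⟨U, ⟨hU, hU'⟩, hKU, hCU⟩ := exists_mem_separating_compacts
    (B := {U : Set X | IsClopen U ∧ IsUpperSet U}) (fun U hU => hU.1)
    ⟨isClopen_empty, isUpperSet_empty⟩ ⟨isClopen_univ, isUpperSet_univ⟩
    (fun U hU V hV => ⟨hU.1.union hV.1, hU.2.union hV.2⟩)
    (fun U hU V hV => ⟨hU.1.inter hV.1, hU.2.inter hV.2⟩) hK.isCompact hC.isCompact
    (fun x hx y hy => by
      obtain ⟨U, hU, hU', hxU, hyU⟩ := exists_isClopen_upper_of_not_le (h x hx y hy)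
      exact ⟨U, ⟨hU, hU'⟩, hxU, hyU⟩)
  exact ⟨⟨⟨U, hU⟩, hU'⟩, hKU, hCU⟩

/-! ### Priestley duality for bounded distributive lattices -/

section PrimeSpectrum

/-- The space of prime filters of a bounded lattice, seen as `Bool`-valued indicator functions,
with the subspace topology and the subspace order of the product `L → Bool`. -/
abbrev PrimeFilterSpace (L : Type u) [DistribLattice L] [BoundedOrder L] : Type u :=
  {p : L → Bool // (p ⊥ = false ∧ p ⊤ = true) ∧
    ∀ a b, p (a ⊔ b) = (p a || p b) ∧ p (a ⊓ b) = (p a && p b)}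

namespace PrimeFilterSpace

variable {L : Type u} [DistribLattice L] [BoundedOrder L]

/-- The points whose prime filter contains `a`. -/
def basic (a : L) : Set (PrimeFilterSpace L) := {p | p.1 a = true}

@[simp] theorem basic_bot : basic (⊥ : L) = ∅ := by
  ext p; simp [basic, p.2.1.1]

@[simp] theorem basic_top : basic (⊤ : L) = Set.univ := by
  ext p; simp [basic, p.2.1.2]

@[simp] theorem basic_sup (a b : L) : basic (a ⊔ b) = basic a ∪ basic b := by
  ext p; simp [basic, (p.2.2 a b).1]

@[simp] theorem basic_inf (a b : L) : basic (a ⊓ b) = basic a ∩ basic b := by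
  ext p; simp [basic, (p.2.2 a b).2]

theorem basic_mono {a b : L} (h : a ≤ b) : basic a ⊆ basic b := by
  rw [← inf_eq_left.2 h, basic_inf]
  exact Set.inter_subset_right

theorem le_iff {p q : PrimeFilterSpace L} : p ≤ q ↔ ∀ a, p ∈ basic a → q ∈ basic a :=
  Iff.rfl

theorem ext_iff_basic {p q : PrimeFilterSpace L} : p = q ↔ ∀ a, p ∈ basic a ↔ q ∈ basic a := by
  rw [Subtype.ext_iff, funext_iff]
  exact forall_congr' fun _ => Bool.eq_iff_iff

/-- The point determined by a prime filter given as a set. -/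
noncomputable def ofSet (F : Set L) (hbot : ⊥ ∉ F) (htop : ⊤ ∈ F)
    (hsup : ∀ a b, a ⊔ b ∈ F ↔ a ∈ F ∨ b ∈ F) (hinf : ∀ a b, a ⊓ b ∈ F ↔ a ∈ F ∧ b ∈ F) :
    PrimeFilterSpace L := by
  classical
  exact ⟨fun a => decide (a ∈ F), by simp [hbot, htop], fun a b => by simp [hsup, hinf]⟩

theorem ofSet_mem_basic {F : Set L} (hbot : ⊥ ∉ F) (htop : ⊤ ∈ F)
    (hsup : ∀ a b, a ⊔ b ∈ F ↔ a ∈ F ∨ b ∈ F) (hinf : ∀ a b, a ⊓ b ∈ F ↔ a ∈ F ∧ b ∈ F) {a : L} :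
    ofSet F hbot htop hsup hinf ∈ basic a ↔ a ∈ F := by
  simp [ofSet, basic]

theorem isClopen_basic (a : L) : IsClopen (basic a) :=
  (isClopen_discrete {true}).preimage ((continuous_apply a).comp continuous_subtype_val)

theorem isUpperSet_basic (a : L) : IsUpperSet (basic a) := fun _ _ h hp => h a hp

/-- Prime filters are cut out of the compact product by equations between continuous functions. -/
instance : CompactSpace (PrimeFilterSpace L) := by
  refine isCompact_iff_compactSpace.1 (IsClosed.isCompact ?_)
  have hc (a : L) : Continuous fun p : L → Bool => p a := continuous_apply a
  have hd (f : Bool × Bool → Bool) : Continuous f := continuous_of_discreteTopology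
  change IsClosed {p : L → Bool | (p ⊥ = false ∧ p ⊤ = true) ∧
    ∀ a b, p (a ⊔ b) = (p a || p b) ∧ p (a ⊓ b) = (p a && p b)}
  simp only [Set.ofPred_and, Set.ofPred_forall]
  refine ((isClosed_eq (hc _) continuous_const).inter (isClosed_eq (hc _) continuous_const)).inter
    (isClosed_iInter fun a => isClosed_iInter fun b => ?_)
  exact (isClosed_eq (hc _) ((hd fun x => x.1 || x.2).comp ((hc a).prodMk (hc b)))).inter
    (isClosed_eq (hc _) ((hd fun x => x.1 && x.2).comp ((hc a).prodMk (hc b))))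

instance : PriestleySpace (PrimeFilterSpace L) where
  priestley {p q} h := by
    rw [le_iff] at h
    push Not at h
    obtain ⟨a, hp, hq⟩ := h
    exact ⟨basic a, isClopen_basic a, isUpperSet_basic a, hp, hq⟩

/-- As `U` is an upset, no point of `U` lies below a point outside it, so some basic set separates
the two points. Compactness turns these into one basic set separating `U` from its complement. -/
theorem exists_eq_basic {U : Set (PrimeFilterSpace L)} (hU : IsClopen U) (hU' : IsUpperSet U) :
    ∃ a, U = basic a := by
  obtain ⟨_, ⟨a, rfl⟩, h₁, h₂⟩ := exists_mem_separating_compacts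
    (B := Set.range (basic : L → _)) (by rintro _ ⟨a, rfl⟩; exact isClopen_basic a)
    ⟨⊥, basic_bot⟩ ⟨⊤, basic_top⟩
    (by rintro _ ⟨a, rfl⟩ _ ⟨b, rfl⟩; exact ⟨a ⊔ b, basic_sup a b⟩)
    (by rintro _ ⟨a, rfl⟩ _ ⟨b, rfl⟩; exact ⟨a ⊓ b, basic_inf a b⟩)
    hU.isClosed.isCompact hU.compl.isClosed.isCompact
    (fun p hp q hq => by
      have h : ¬ p ≤ q := fun h => hq (hU' h hp)
      rw [le_iff] at h
      push Not at h
      obtain ⟨a, hp, hq⟩ := h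
      exact ⟨basic a, ⟨a, rfl⟩, hp, hq⟩)
  exact ⟨a, h₁.antisymm (Set.compl_subset_compl.1 h₂)⟩

/-- The prime filter theorem, for a filter base `F` and an ideal base `I`. -/
theorem exists_separating {F I : Set L} (hFtop : ⊤ ∈ F) (hFinf : ∀ a ∈ F, ∀ b ∈ F, a ⊓ b ∈ F)
    (hIbot : ⊥ ∈ I) (hIsup : ∀ a ∈ I, ∀ b ∈ I, a ⊔ b ∈ I) (h : ∀ a ∈ F, ∀ b ∈ I, ¬ a ≤ b) :
    ∃ p : PrimeFilterSpace L, (∀ a ∈ F, p ∈ basic a) ∧ ∀ b ∈ I, p ∉ basic b := by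
  have hF' : Order.IsPFilter {c | ∃ a ∈ F, a ≤ c} := .of_def ⟨⊤, ⊤, hFtop, le_rfl⟩
    (by
      rintro c ⟨a, ha, hac⟩ d ⟨b, hb, hbd⟩
      exact ⟨c ⊓ d, ⟨a ⊓ b, hFinf a ha b hb, inf_le_inf hac hbd⟩, inf_le_left, inf_le_right⟩)
    (by
      rintro c d hcd ⟨a, ha, hac⟩
      exact ⟨a, ha, hac.trans hcd⟩)
  have hI' : Order.IsIdeal {c | ∃ a ∈ I, c ≤ a} :=
    { IsLowerSet := by
        rintro c d hdc ⟨a, ha, hca⟩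
        exact ⟨a, ha, hdc.trans hca⟩
      Nonempty := ⟨⊥, ⊥, hIbot, le_rfl⟩
      Directed := by
        rintro c ⟨a, ha, hca⟩ d ⟨b, hb, hdb⟩
        exact ⟨c ⊔ d, ⟨a ⊔ b, hIsup a ha b hb, sup_le_sup hca hdb⟩, le_sup_left, le_sup_right⟩ }
  obtain ⟨J, hJ, hIJ, hFJ⟩ := DistribLattice.prime_ideal_of_disjoint_filter_ideal
    (F := hF'.toPFilter) (I := hI'.toIdeal) (by
      refine Set.disjoint_left.2 ?_
      rintro c ⟨a, ha, hac⟩ ⟨b, hb, hcb⟩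
      exact h a ha b hb (LE.le.trans hac hcb))
  refine ⟨ofSet {a | a ∉ J} (by simp) ?_ (fun a b => ?_) (fun a b => ?_), fun a ha => ?_,
    fun b hb => ?_⟩
  · exact (Order.Ideal.isProper_iff_top_notMem.1 hJ.toIsProper)
  · simp only [Set.mem_ofPred_eq, Order.Ideal.sup_mem_iff]
    tauto
  · simp only [Set.mem_ofPred_eq, ← not_or, not_iff_not]
    exact ⟨hJ.mem_or_mem, fun h => h.elim (J.lower inf_le_left) (J.lower inf_le_right)⟩
  · exact (ofSet_mem_basic ..).2 (Set.disjoint_left.1 hFJ ⟨a, ha, le_rfl⟩)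
  · exact fun hp => (ofSet_mem_basic ..).1 hp (hIJ ⟨b, hb, le_rfl⟩)

theorem basic_subset_basic {a b : L} : basic a ⊆ basic b ↔ a ≤ b := by
  refine ⟨fun h => ?_, basic_mono⟩
  by_contra hab
  obtain ⟨p, hp, hp'⟩ := exists_separating (F := {⊤, a}) (I := {⊥, b}) (by simp) (by simp)
    (by simp) (by simp) (by
      rintro x (rfl | rfl) y (rfl | rfl) hxy
      · exact hab (le_top.trans (hxy.trans bot_le))
      · exact hab (le_top.trans hxy)
      · exact hab (hxy.trans bot_le)
      · exact hab hxy)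
  exact hp' b (by simp) (h (hp a (by simp)))

theorem basic_injective : Function.Injective (basic : L → Set (PrimeFilterSpace L)) :=
  fun _ _ h => le_antisymm (basic_subset_basic.1 h.subset) (basic_subset_basic.1 h.symm.subset)

/-- The map of prime filter spaces given by preimages under a bounded lattice homomorphism. -/
def comap {M : Type u} [DistribLattice M] [BoundedOrder M] (f : BoundedLatticeHom L M)
    (p : PrimeFilterSpace M) : PrimeFilterSpace L :=
  ⟨fun a => p.1 (f a), by simp [p.2.1], fun a b => by simp [p.2.2]⟩

theorem comap_mem_basic {M : Type u} [DistribLattice M] [BoundedOrder M]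
    {f : BoundedLatticeHom L M} {p : PrimeFilterSpace M} {a : L} :
    comap f p ∈ basic a ↔ p ∈ basic (f a) := Iff.rfl

theorem continuous_comap {M : Type u} [DistribLattice M] [BoundedOrder M]
    (f : BoundedLatticeHom L M) : Continuous (comap f) :=
  Continuous.subtype_mk (f := fun (p : PrimeFilterSpace M) (a : L) => p.1 (f a))
    (continuous_pi fun a => (continuous_apply (f a)).comp continuous_subtype_val) _

end PrimeFilterSpace

end PrimeSpectrum

/-! ### From positive modal algebras to modal Priestley spaces -/

namespace PMA

open PrimeFilterSpace

theorem dia_mono (L : PMA.{u}) : Monotone L.dia := fun a b h => by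
  rw [← sup_eq_right.2 h, ← L.dia_sup]
  exact le_sup_left

theorem box_mono (L : PMA.{u}) : Monotone L.box := fun a b h => by
  rw [← inf_eq_left.2 h, ← L.box_inf]
  exact inf_le_right

/-- The accessibility relation on the prime filters of a positive modal algebra. -/
def specRel (L : PMA.{u}) (p q : PrimeFilterSpace L) : Prop :=
  (∀ a, p ∈ basic (L.box a) → q ∈ basic a) ∧ ∀ a, q ∈ basic a → p ∈ basic (L.dia a)

/-- The point `q` must contain `□⁻¹p` and avoid both `I` and the complement of `◇⁻¹p`. If `□c ∈ p`
and `c ≤ a ⊔ b` with `a ∈ I` and `◇b ∉ p`, then `□a ⊔ ◇b ∈ p` by `box_sup_le`, against primality of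
`p`; so the prime filter theorem applies. -/
theorem exists_specRel_avoiding (L : PMA.{u}) {p : PrimeFilterSpace L} {I : Set L}
    (hbot : ⊥ ∈ I) (hsup : ∀ a ∈ I, ∀ b ∈ I, a ⊔ b ∈ I) (hI : ∀ a ∈ I, p ∉ basic (L.box a)) :
    ∃ q, L.specRel p q ∧ ∀ a ∈ I, q ∉ basic a := by
  obtain ⟨q, hq, hq'⟩ := exists_separating (F := {a | p ∈ basic (L.box a)})
    (I := {c | ∃ a ∈ I, ∃ b, p ∉ basic (L.dia b) ∧ c = a ⊔ b})
    (by simp [L.box_top])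
    (fun a ha b hb => by
      change p ∈ basic _
      rw [← L.box_inf, basic_inf]
      exact ⟨ha, hb⟩)
    ⟨⊥, hbot, ⊥, by simp [L.dia_bot], by simp⟩
    (by
      rintro _ ⟨a, ha, b, hb, rfl⟩ _ ⟨a', ha', b', hb', rfl⟩
      refine ⟨a ⊔ a', hsup a ha a' ha', b ⊔ b', ?_, sup_sup_sup_comm ..⟩
      rw [← L.dia_sup, basic_sup]
      exact fun h => h.elim hb hb')
    (by
      rintro c hc _ ⟨a, ha, b, hb, rfl⟩ hle
      have := basic_mono ((L.box_mono hle).trans (L.box_sup_le a b)) hc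
      rw [basic_sup] at this
      exact this.elim (hI a ha) hb)
  refine ⟨q, ⟨hq, fun a ha => ?_⟩, fun a ha => hq' a ⟨a, ha, ⊥, by simp [L.dia_bot], by simp⟩⟩
  by_contra hp
  exact hq' a ⟨⊥, hbot, a, hp, by simp⟩ ha

/-- Order dual of the preceding argument, with `box_inf_dia_le` as the mixed axiom. -/
theorem exists_specRel_containing (L : PMA.{u}) {p : PrimeFilterSpace L} {F : Set L}
    (htop : ⊤ ∈ F) (hinf : ∀ a ∈ F, ∀ b ∈ F, a ⊓ b ∈ F) (hF : ∀ a ∈ F, p ∈ basic (L.dia a)) :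
    ∃ q, L.specRel p q ∧ ∀ a ∈ F, q ∈ basic a := by
  obtain ⟨q, hq, hq'⟩ := exists_separating
    (F := {c | ∃ a ∈ F, ∃ b, p ∈ basic (L.box b) ∧ c = b ⊓ a})
    (I := {a | p ∉ basic (L.dia a)})
    ⟨⊤, htop, ⊤, by simp [L.box_top], by simp⟩
    (by
      rintro _ ⟨a, ha, b, hb, rfl⟩ _ ⟨a', ha', b', hb', rfl⟩
      refine ⟨a ⊓ a', hinf a ha a' ha', b ⊓ b', ?_, inf_inf_inf_comm ..⟩
      rw [← L.box_inf, basic_inf]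
      exact ⟨hb, hb'⟩)
    (by simp [L.dia_bot])
    (fun a ha b hb => by
      change p ∉ basic _
      rw [← L.dia_sup, basic_sup]
      exact fun h => h.elim ha hb)
    (by
      rintro _ ⟨a, ha, b, hb, rfl⟩ c hc hle
      refine hc (basic_mono ((L.box_inf_dia_le b a).trans (L.dia_mono hle)) ?_)
      rw [basic_inf]
      exact ⟨hb, hF a ha⟩)
  refine ⟨q, ⟨fun a ha => hq a ⟨⊤, htop, a, ha, by simp⟩, fun a ha => ?_⟩,
    fun a ha => hq a ⟨a, ha, ⊤, by simp [L.box_top], by simp⟩⟩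
  by_contra hp
  exact hq' a hp ha

theorem boxRel_basic (L : PMA.{u}) (a : L) : boxRel L.specRel (basic a) = basic (L.box a) := by
  ext p
  refine ⟨fun h => ?_, fun h q hq => hq.1 a h⟩
  by_contra hp
  obtain ⟨q, hq, hq'⟩ := L.exists_specRel_avoiding (I := Set.Iic a) bot_le
    (fun _ h _ h' => sup_le h h') (fun b hb h => hp (basic_mono (L.box_mono hb) h))
  exact hq' a le_rfl (h hq)

theorem diaRel_basic (L : PMA.{u}) (a : L) : diaRel L.specRel (basic a) = basic (L.dia a) := by
  ext p
  refine ⟨fun ⟨q, hq, hpq⟩ => hpq.2 a hq, fun h => ?_⟩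
  obtain ⟨q, hq, hq'⟩ := L.exists_specRel_containing (F := Set.Ici a) le_top
    (fun _ h _ h' => le_inf h h') (fun b hb => basic_mono (L.dia_mono hb) h)
  exact ⟨q, hq' a le_rfl, hq⟩

/-- The modal Priestley space of prime filters of a positive modal algebra. -/
def spec (L : PMA.{u}) : MPS.{u} where
  carrier := PrimeFilterSpace L
  rel := L.specRel
  isClosed_rel p := by
    simp only [specRel, Set.ofPred_and, Set.ofPred_forall]
    refine (isClosed_iInter fun a => isClosed_iInter fun _ => (isClopen_basic a).isClosed).inter
      (isClosed_iInter fun a => ?_)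
    -- With `p` fixed, the condition at `a` is either vacuous or says that the point lies outside
    -- `basic a`.
    by_cases h : p ∈ basic (L.dia a)
    · simp [h]
    · simp only [h, imp_false]
      exact (isClopen_basic a).compl.isClosed
  isClopen_isUpperSet U hU hU' := by
    obtain ⟨a, rfl⟩ := exists_eq_basic hU hU'
    rw [boxRel_basic, diaRel_basic]
    exact ⟨⟨isClopen_basic _, isUpperSet_basic _⟩, isClopen_basic _, isUpperSet_basic _⟩
  rel_eq p := by
    refine (Set.subset_inter subset_upperClosure subset_lowerClosure).antisymm ?_
    rintro q ⟨⟨q₁, h₁, hq₁⟩, q₂, h₂, hq₂⟩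
    -- The `□` half of `specRel` is upward closed in `q`, the `◇` half downward closed.
    exact ⟨fun a ha => hq₁ a (h₁.1 a ha), fun a ha => h₂.2 a (hq₂ a ha)⟩

/-- For `z`, avoid the images of all elements outside `r`; for `w`, contain the images of all
elements of `r`. The `□` and `◇` halves of `h` are exactly what permits this. -/
theorem exists_specRel_of_specRel_comap {L M : PMA.{u}} (f : L ⟶ M) {p : PrimeFilterSpace M}
    {r : PrimeFilterSpace L} (h : L.specRel (comap (Hom.hom f) p) r) :
    ∃ z w, M.specRel p z ∧ M.specRel p w ∧ comap (Hom.hom f) z ≤ r ∧ r ≤ comap (Hom.hom f) w := by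
  obtain ⟨z, hz, hz'⟩ := M.exists_specRel_avoiding (p := p) (I := Hom.hom f '' {a | r ∉ basic a})
    ⟨⊥, by simp, map_bot _⟩
    (by
      rintro _ ⟨a, ha, rfl⟩ _ ⟨b, hb, rfl⟩
      refine ⟨a ⊔ b, ?_, map_sup ..⟩
      rw [Set.mem_ofPred_eq, basic_sup]
      exact fun h => h.elim ha hb)
    (by
      rintro _ ⟨a, ha, rfl⟩ hp
      rw [← Hom.map_box f] at hp
      exact ha (h.1 a hp))
  obtain ⟨w, hw, hw'⟩ := M.exists_specRel_containing (p := p) (F := Hom.hom f '' {a | r ∈ basic a})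
    ⟨⊤, by simp, map_top _⟩
    (by
      rintro _ ⟨a, ha, rfl⟩ _ ⟨b, hb, rfl⟩
      refine ⟨a ⊓ b, ?_, map_inf ..⟩
      rw [Set.mem_ofPred_eq, basic_inf]
      exact ⟨ha, hb⟩)
    (by
      rintro _ ⟨a, ha, rfl⟩
      rw [← Hom.map_dia f]
      exact h.2 a ha)
  refine ⟨z, w, hz, hw, fun a ha => ?_, fun a ha => hw' _ ⟨a, ha, rfl⟩⟩
  by_contra hr
  exact hz' _ ⟨a, hr, rfl⟩ ha

/-- The p-morphism induced by a homomorphism of positive modal algebras. -/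
def specMap {L M : PMA.{u}} (f : L ⟶ M) : M.spec ⟶ L.spec where
  toFun := comap (Hom.hom f)
  continuous := continuous_comap _
  isPMorphism :=
    { monotone := fun _ _ h a ha => h (Hom.hom f a) ha
      forth := fun p q h => by
        refine ⟨fun a ha => h.1 _ ?_, fun a ha => ?_⟩
        · rwa [← Hom.map_box f]
        · refine comap_mem_basic.2 ?_
          rw [Hom.map_dia f]
          exact h.2 _ ha
      back := fun _ _ h => exists_specRel_of_specRel_comap f h }

/-- The functor sending a positive modal algebra to its modal Priestley space. -/
def specFunctor : PMA.{u}ᵒᵖ ⥤ MPS.{u} where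
  obj L := L.unop.spec
  map f := specMap f.unop
  map_id _ := rfl
  map_comp _ _ := rfl

instance : specFunctor.{u}.Faithful where
  map_injective {L M f g} h := by
    refine Quiver.Hom.unop_inj (Hom.ext (DFunLike.ext _ _ fun a => basic_injective ?_))
    ext p
    exact iff_of_eq (congrArg (· ∈ basic a) (congrFun (congrArg MPS.Hom.toFun h) p))

/-- Every continuous p-morphism between spaces of prime filters is induced by a homomorphism. -/
theorem exists_specMap_eq {L M : PMA.{u}} (g : M.spec ⟶ L.spec) : ∃ f : L ⟶ M, specMap f = g := by
  let G : PrimeFilterSpace M → PrimeFilterSpace L := MPS.Hom.toFun g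
  have hGc : Continuous G := MPS.Hom.continuous g
  have hG : MPS.IsPMorphism (X := M.spec) (Y := L.spec) G := MPS.Hom.isPMorphism g
  have hpre (a : L) : ∃ b : M, G ⁻¹' basic a = basic b :=
    exists_eq_basic ((isClopen_basic a).preimage hGc)
      ((isUpperSet_basic a).preimage hG.monotone)
  choose f hf using hpre
  refine ⟨⟨{ toFun := f, map_sup' := ?_, map_inf' := ?_, map_top' := ?_, map_bot' := ?_ },
    fun a => ?_, fun a => ?_⟩, ?_⟩
  · intro a b
    apply basic_injective
    rw [basic_sup, ← hf, ← hf, ← hf, basic_sup, Set.preimage_union]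
  · intro a b
    apply basic_injective
    rw [basic_inf, ← hf, ← hf, ← hf, basic_inf, Set.preimage_inter]
  · apply basic_injective
    simp only [← hf, basic_top, Set.preimage_univ]
  · apply basic_injective
    simp only [← hf, basic_bot, Set.preimage_empty]
  · apply basic_injective
    change basic (f _) = basic (M.dia (f a))
    rw [← hf, ← diaRel_basic, ← diaRel_basic, ← hf]
    ext p
    constructor
    · rintro ⟨r, hr, hpr⟩
      -- Basic sets are upsets, so `◇` needs the witness above `r`; `□` below needs the one under
      -- `r`.
      obtain ⟨_, z, _, hz, _, hrz⟩ := hG.back p r hpr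
      exact ⟨z, isUpperSet_basic a hrz hr, hz⟩
    · rintro ⟨q, hq, hpq⟩
      exact ⟨G q, hq, hG.forth p q hpq⟩
  · apply basic_injective
    change basic (f _) = basic (M.box (f a))
    rw [← hf, ← boxRel_basic, ← boxRel_basic, ← hf]
    ext p
    constructor
    · exact fun h q hpq => h (hG.forth p q hpq)
    · intro h r hpr
      obtain ⟨z, _, hz, _, hzr, _⟩ := hG.back p r hpr
      exact isUpperSet_basic a hzr (h hz)
  · refine MPS.Hom.ext (funext fun p => ext_iff_basic.2 fun a => ?_)
    change p ∈ basic (f a) ↔ p ∈ G ⁻¹' basic a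
    rw [hf]

instance : specFunctor.{u}.Full where
  map_surjective g := by
    obtain ⟨f, hf⟩ := exists_specMap_eq g
    exact ⟨f.op, hf⟩

end PMA

/-! ### From modal Priestley spaces back to algebras -/

namespace MPS

open PrimeFilterSpace

instance ClopenUpperSet.instDistribLattice (X : Type*) [TopologicalSpace X] [PartialOrder X] :
    DistribLattice (ClopenUpperSet X) where
  le_sup_inf a b c := by
    have h : ((a : Set X) ∪ b) ∩ (a ∪ c) ⊆ a ∪ b ∩ c := (Set.union_inter_distrib_left ..).ge
    exact h

/-- The positive modal algebra of clopen upper sets of a modal Priestley space. -/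
def clopenUpperSets (X : MPS.{u}) : PMA.{u} where
  carrier := ClopenUpperSet X
  dia U := ⟨⟨diaRel X.rel U, (X.isClopen_isUpperSet U U.isClopen U.upper).2.1⟩,
    (X.isClopen_isUpperSet U U.isClopen U.upper).2.2⟩
  box U := ⟨⟨boxRel X.rel U, (X.isClopen_isUpperSet U U.isClopen U.upper).1.1⟩,
    (X.isClopen_isUpperSet U U.isClopen U.upper).1.2⟩
  dia_bot := by
    ext x
    exact ⟨fun ⟨_, hy, _⟩ => hy, False.elim⟩
  dia_sup U V := by
    ext x
    constructor
    · rintro (⟨y, hy, h⟩ | ⟨y, hy, h⟩)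
      exacts [⟨y, Or.inl hy, h⟩, ⟨y, Or.inr hy, h⟩]
    · rintro ⟨y, hy | hy, h⟩
      exacts [Or.inl ⟨y, hy, h⟩, Or.inr ⟨y, hy, h⟩]
  box_top := by
    ext x
    exact ⟨fun _ => trivial, fun _ _ _ => trivial⟩
  box_inf U V := by
    ext x
    exact ⟨fun h y hy => ⟨h.1 hy, h.2 hy⟩, fun h => ⟨fun y hy => (h hy).1, fun y hy => (h hy).2⟩⟩
  box_sup_le U V x h := by
    by_cases hV : ∃ y ∈ (V : Set X), X.rel x y
    · exact Or.inr hV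
    · exact Or.inl fun y hy => (h hy).resolve_right fun hyV => hV ⟨y, hyV, hy⟩
  box_inf_dia_le U V := by
    rintro x ⟨hU, y, hy, hxy⟩
    exact ⟨y, ⟨hU hxy, hy⟩, hxy⟩

/-- The prime filter of clopen upper sets containing a given point. -/
noncomputable def toSpec (X : MPS.{u}) (x : X) : PrimeFilterSpace (ClopenUpperSet X) :=
  ofSet {U | x ∈ (U : Set X)} (fun h => h) trivial (fun _ _ => Iff.rfl) (fun _ _ => Iff.rfl)

theorem toSpec_mem_basic {X : MPS.{u}} {x : X} {U : ClopenUpperSet X} :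
    X.toSpec x ∈ basic U ↔ x ∈ (U : Set X) :=
  ofSet_mem_basic ..

theorem toSpec_le_toSpec {X : MPS.{u}} {x y : X} : X.toSpec x ≤ X.toSpec y ↔ x ≤ y := by
  simp only [le_iff, toSpec_mem_basic]
  refine ⟨fun h => ?_, fun h U hx => U.upper h hx⟩
  by_contra hxy
  obtain ⟨U, hU, hU', hx, hy⟩ := exists_isClopen_upper_of_not_le hxy
  exact hy (h ⟨⟨U, hU⟩, hU'⟩ hx)

theorem continuous_toSpec (X : MPS.{u}) : Continuous X.toSpec := by
  refine Continuous.subtype_mk (continuous_pi fun U => ?_) _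
  refine (continuous_bool_rng true).2 ?_
  convert U.isClopen using 1
  ext x
  exact toSpec_mem_basic

/-- The sets `V \ W` with `V ∈ p` and `W ∉ p` are closed and directed, and nonempty since `V ⊆ W`
would put `W` in `p`. By compactness they share a point, whose filter is `p`. -/
theorem toSpec_surjective (X : MPS.{u}) : Function.Surjective X.toSpec := by
  intro p
  let ι := {V : ClopenUpperSet X × ClopenUpperSet X // p ∈ basic V.1 ∧ p ∉ basic V.2}
  let t : ι → Set X := fun V => (V.1.1 : Set X) \ V.1.2
  have hι : Nonempty ι := ⟨(⊤, ⊥), by simp, by simp⟩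
  have hclosed (V : ι) : IsClosed (t V) := (V.1.1.isClopen.diff V.1.2.isClopen).isClosed
  obtain ⟨x, hx⟩ := IsCompact.nonempty_iInter_of_directed_nonempty_isCompact_isClosed t
    (fun V W => by
      refine ⟨⟨(V.1.1 ⊓ W.1.1, V.1.2 ⊔ W.1.2), ?_, ?_⟩, fun x hx => ?_, fun x hx => ?_⟩
      · rw [basic_inf]
        exact ⟨V.2.1, W.2.1⟩
      · rw [basic_sup]
        exact fun h => h.elim V.2.2 W.2.2
      · exact ⟨hx.1.1, fun h => hx.2 (Or.inl h)⟩
      · exact ⟨hx.1.2, fun h => hx.2 (Or.inr h)⟩)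
    (fun V => Set.sdiff_nonempty.2 fun h => V.2.2 (basic_mono (a := V.1.1) h V.2.1))
    (fun V => (hclosed V).isCompact) hclosed
  rw [Set.mem_iInter] at hx
  refine ⟨x, ext_iff_basic.2 fun U => ?_⟩
  rw [toSpec_mem_basic]
  constructor
  · intro hxU
    by_contra hp
    exact (hx ⟨(⊤, U), by simp, hp⟩).2 hxU
  · exact fun hp => (hx ⟨(U, ⊥), hp, by simp⟩).1

/-- By `rel_eq` it suffices that `y` lies above and below points of `R[x]`. If it lies above none, a
clopen upset containing `R[x]` and missing `y` violates the `□` half; if below none, one containing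
`y` and disjoint from `R[x]` violates the `◇` half. -/
theorem specRel_toSpec {X : MPS.{u}} {x y : X} :
    X.clopenUpperSets.specRel (X.toSpec x) (X.toSpec y) ↔ X.rel x y := by
  constructor
  · rintro ⟨hbox, hdia⟩
    change y ∈ {y | X.rel x y}
    rw [X.rel_eq x]
    constructor
    · by_contra hy
      obtain ⟨U, hU, hyU⟩ := exists_clopenUpperSet_separating (X.isClosed_rel x)
        (isClosed_singleton (x := y)) (by
          rintro r hr _ rfl hle
          exact hy ⟨r, hr, hle⟩)
      exact hyU rfl (toSpec_mem_basic.1 (hbox U (toSpec_mem_basic.2 hU)))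
    · by_contra hy
      obtain ⟨U, hyU, hU⟩ := exists_clopenUpperSet_separating (isClosed_singleton (x := y))
        (X.isClosed_rel x) (by
          rintro _ rfl r hr hle
          exact hy ⟨r, hr, hle⟩)
      obtain ⟨r, hr, hxr⟩ := toSpec_mem_basic.1 (hdia U (toSpec_mem_basic.2 (hyU rfl)))
      exact hU hxr hr
  · refine fun h => ⟨fun U hU => ?_, fun U hU => ?_⟩
    · exact toSpec_mem_basic.2 (toSpec_mem_basic.1 hU h)
    · exact toSpec_mem_basic.2 ⟨y, toSpec_mem_basic.1 hU, h⟩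

/-- A surjection preserving and reflecting the order and the relation is a p-morphism. -/
theorem IsPMorphism.of_surjective {X Y : MPS.{u}} {f : X → Y} (hf : Function.Surjective f)
    (hle : ∀ x y, f x ≤ f y ↔ x ≤ y) (hrel : ∀ x y, Y.rel (f x) (f y) ↔ X.rel x y) :
    IsPMorphism f where
  monotone x y := (hle x y).2
  forth x y := (hrel x y).2
  back x y h := by
    obtain ⟨z, rfl⟩ := hf y
    exact ⟨z, z, (hrel x z).1 h, (hrel x z).1 h, le_rfl, le_rfl⟩

/-- A continuous surjection preserving and reflecting the order and the relation is an
isomorphism of modal Priestley spaces. -/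
noncomputable def isoOfSurjective {X Y : MPS.{u}} (f : X → Y) (hc : Continuous f)
    (hf : Function.Surjective f) (hle : ∀ x y, f x ≤ f y ↔ x ≤ y)
    (hrel : ∀ x y, Y.rel (f x) (f y) ↔ X.rel x y) : X ≅ Y :=
  have hinj : Function.Injective f := fun x y h =>
    le_antisymm ((hle x y).1 h.le) ((hle y x).1 h.ge)
  let e : X ≃ Y := Equiv.ofBijective f ⟨hinj, hf⟩
  have he (y : Y) : f (e.symm y) = y := e.apply_symm_apply y
  { hom := Hom.mk f hc (.of_surjective hf hle hrel)
    -- A continuous bijection from a compact space to a Hausdorff one has continuous inverse.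
    inv := Hom.mk e.symm (hc.continuous_symm_of_equiv_compact_to_t2 (f := e))
      (.of_surjective e.symm.surjective (fun x y => by rw [← hle, he, he])
        (fun x y => by rw [← hrel, he, he]))
    hom_inv_id := Hom.ext (funext e.symm_apply_apply)
    inv_hom_id := Hom.ext (funext e.apply_symm_apply) }

/-- A modal Priestley space is isomorphic to its double dual. -/
noncomputable def isoSpec (X : MPS.{u}) : X ≅ X.clopenUpperSets.spec :=
  isoOfSurjective (Y := X.clopenUpperSets.spec) X.toSpec X.continuous_toSpec X.toSpec_surjective
    (fun _ _ => toSpec_le_toSpec) (fun _ _ => specRel_toSpec)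

end MPS

instance : PMA.specFunctor.{u}.EssSurj where
  mem_essImage X := ⟨Opposite.op X.clopenUpperSets, ⟨X.isoSpec.symm⟩⟩

theorem mainTheorem1 : Nonempty (PMA.{u}ᵒᵖ ≌ MPS.{u}) := by
  have : PMA.specFunctor.{u}.IsEquivalence := { }
  exact ⟨PMA.specFunctor.asEquivalence⟩
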